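/- Let $R>0$ and $n\in\mathbb{N}$, let $h$ be a real continuous function on $[-R,R]^n$ and let $\mu_1,\dots,\mu_n$ be Borel probability measures on $[-R,R]$. Write $P(h):=\log\int_{[-R,R]^n}e^{h(\mathbf x)}\,d\mathbf x$ for the pressure of $h$, and let the Gibbs measure associated with a real continuous function $g$ on $[-R,R]^m$ be the probability measure with density $e^{g}/\int_{[-R,R]^m} e^{g}\,d\mathbf x$ with respect to Lebesgue measure. The Boltzmann–Gibbs entropy of a probability measure $\nu$ on $[-R,R]$ is $H(\nu):=-\int_{-R}^{R} p\log p\,dx\in[-\infty,\infty)$ if $\nu$ has a density $p$ with respect to Lebesgue measure, and $H(\nu):=-\infty$ otherwise. An approximating sequence for $(\mu_1,\dots,\mu_n)$ consists of vectors $\xi_i(N)\in[-R,R]^N$ ($1\le i\le n$, $N\in\mathbb{N}$) with increasing coordinates $\xi_i(N)_1\le\dots\le\xi_i(N)_N$ such that $\frac1N\sum_{j=1}^N \xi_i(N)_j^k\to\int x^k\,d\mu_i(x)$ as $N\to\infty$ for all $k\in\mathbb{N}$ and all $i$. Such sequences exist. For any approximating sequence, define the mutual pressure $$ P_{\mathrm{sym}}(h:\mu_1,\dots,\mu_n):=\limsup_{N\to\infty}\frac1N\log\Biggl[\frac1{(N!)^n}\sum_{\sigma_1,\dots,\sigma_n\in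 S_N}\exp\Bigl(\sum_{j=1}^N h\bigl(\xi_1(N)_{\sigma_1^{-1}(j)},\dots,\xi_n(N)_{\sigma_n^{-1}(j)}\bigr)\Bigr)\Biggr]. $$ Then, for every choice of the approximating sequence, $$ P(h)\ge P_{\mathrm{sym}}(h:\mu_1,\dots,\mu_n)+\sum_{i=1}^nH(\mu_i). $$ Moreover the following conditions are equivalent: (i) $P(h)=P_{\mathrm{sym}}(h:\mu_1,\dots,\mu_n)+\sum_{i=1}^nH(\mu_i)$; (ii) $\mu_1,\dots,\mu_n$ are the marginals of the Gibbs measure associated with $h$; (iii) for each $i=1,\dots,n$, $\mu_i$ is the Gibbs measure associated with the function $h_i$ on $[-R,R]$ (which is continuous) defined by $$ h_i(x):=\log\int_{[-R,R]^{n-1}}e^{h(x_1,\dots,x_{i-1},x,x_{i+1},\dots,x_n)}\,dx_1\cdots dx_{i-1}\,dx_{i+1}\cdots dx_n . $$ -/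

import Mathlib

open MeasureTheory Filter Topology

noncomputable section

/-- The interval `[-R, R]`. -/
abbrev SymInterval (R : ℝ) : Type := Set.Icc (-R) R

/-- Lebesgue measure on `[-R, R]`. The cube `Fin n → SymInterval R` then carries the product
measure, i.e. `n`-dimensional Lebesgue measure. -/
instance SymInterval.measureSpace (R : ℝ) : MeasureSpace (SymInterval R) where
  volume := Measure.comap Subtype.val volume

/-- The Boltzmann–Gibbs entropy `H(μ) = -∫ p log p dx` of a probability measure on `[-R, R]` with
density `p`, and `-∞` if `μ` has no density. As `p log p` is bounded below on a set of finite
Lebesgue measure, its integral always exists in `(-∞, +∞]`; it is `+∞`, so that `H(μ) = -∞`,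
exactly when `p log p` is not integrable. -/
def entropy {R : ℝ} (μ : ProbabilityMeasure (SymInterval R)) : EReal :=
  open Classical in
  let p : SymInterval R → ℝ := fun x => ((μ : Measure (SymInterval R)).rnDeriv volume x).toReal
  if (μ : Measure (SymInterval R)) ≪ volume ∧
      Integrable (fun x => p x * Real.log (p x)) volume then
    ((-∫ x, p x * Real.log (p x) : ℝ) : EReal)
  else ⊥

/-- The pressure `P(h) = log ∫ e^h dx` on the cube `[-R, R]^n`. -/
def pressure {R : ℝ} {n : ℕ} (h : C(Fin n → SymInterval R, ℝ)) : ℝ :=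
  Real.log (∫ x, Real.exp (h x))

/-- The Gibbs measure `dμ_h = Z_h⁻¹ e^h dx`, where `Z_h = ∫ e^h dx`. -/
def gibbsMeasure {α : Type*} [MeasureSpace α] (h : α → ℝ) : Measure α :=
  (volume : Measure α).tilted h

/-- The mean value of a vector in `ℝ^N`. -/
def meanValue {N : ℕ} (x : Fin N → ℝ) : ℝ :=
  (1 / (N : ℝ)) * ∑ j, x j

/-- `Ξ N i` is the vector `ξ_i(N) ∈ [-R, R]^N`. The sequence `Ξ` is approximating for
`(μ_1, …, μ_n)` if every `ξ_i(N)` has increasing coordinates and `ξ_i(N) → μ_i` in moments. -/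
structure IsApproximatingSequence {R : ℝ} {n : ℕ}
    (Ξ : (N : ℕ) → Fin n → Fin N → SymInterval R)
    (μ : Fin n → ProbabilityMeasure (SymInterval R)) : Prop where
  monotone : ∀ N i, Monotone (Ξ N i)
  tendsto_moment : ∀ (i : Fin n) (k : ℕ),
    Tendsto (fun N => meanValue (fun j => (Ξ N i j : ℝ) ^ k)) atTop
      (𝓝 (∫ x, (x : ℝ) ^ k ∂(μ i : Measure (SymInterval R))))

/-- The action of `S_N` on vectors: `σ(x) = (x_{σ⁻¹(1)}, …, x_{σ⁻¹(N)})`. -/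
def permute {α : Type*} {N : ℕ} (σ : Equiv.Perm (Fin N)) (x : Fin N → α) : Fin N → α :=
  fun j => x (σ⁻¹ j)

/-- For `x_1, …, x_n ∈ [-R, R]^N`, the vector `(h(x_{11}, …, x_{n1}), …, h(x_{1N}, …, x_{nN}))`. -/
def applyCoordwise {R : ℝ} {n N : ℕ} (h : C(Fin n → SymInterval R, ℝ))
    (x : Fin n → Fin N → SymInterval R) : Fin N → ℝ :=
  fun j => h (fun i => x i j)

/-- The mutual pressure `P_sym(h : μ_1, …, μ_n)`, computed along an approximating sequence `Ξ` for
`(μ_1, …, μ_n)`. -/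
def mutualPressure {R : ℝ} {n : ℕ} (h : C(Fin n → SymInterval R, ℝ))
    (Ξ : (N : ℕ) → Fin n → Fin N → SymInterval R) : EReal :=
  limsup (fun N : ℕ => (((1 / (N : ℝ)) * Real.log ((1 / (N.factorial : ℝ) ^ n) *
    ∑ σ : Fin n → Equiv.Perm (Fin N),
      Real.exp (N * meanValue (applyCoordwise h (fun i => permute (σ i) (Ξ N i))))) : ℝ) : EReal))
    atTop

/-- The marginal potential `h_i(x) = log ∫ e^{h(x_1, …, x_{i-1}, x, x_{i+1}, …, x_n)}`, where the
integral is over the variables `x_j` with `j ≠ i`. -/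
def marginalPotential {R : ℝ} {n : ℕ} (h : C(Fin n → SymInterval R, ℝ)) (i : Fin n)
    (x : SymInterval R) : ℝ :=
  Real.log (∫ y : {j : Fin n // j ≠ i} → SymInterval R,
    Real.exp (h (fun j => if hj : j = i then x else y ⟨j, hj⟩)))

end

/-!
Along approximating sequences, `Φ_N(h) = N⁻¹ log E_σ exp(∑_j h(ξ_{σ,j}))`, with `σ` uniform in
`S_N^n`, does not depend asymptotically on the sequence: monotone vectors with the same limit law
are close in mean `ℓ¹` distance, and `Φ_N` is continuous for that distance. Hence `Φ_N` may be
replaced by its average over the columns of an i.i.d. sample of any coupling `ν` of the `μ_i`.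

A product reference measure `m` is invariant under permuting the entries of the columns, so
`∫ exp(N Φ_N) dm^N = (∫ e^h dm)^N`. With `m` the Lebesgue measure and `ν = ∏ μ_i`, entropy duality
turns this into the inequality. A separable potential `∑ f_i(x_i)` shifts `P_sym` by exactly
`∑ ∫ f_i dμ_i`; when equality holds at `h`, the convex function
`t ↦ P(h + t ∑ f_i) - t ∑ ∫ f_i dμ_i` is minimal at `t = 0`, and its derivative there identifies
the `μ_i` as the marginals of the Gibbs measure. Conversely, if `ν` is the Gibbs measure, Jensen's
inequality for `exp(N Φ_N)` tilting the product of its marginals gives the opposite bound.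
-/

section Averages

theorem natCast_mul_meanValue {N : ℕ} (x : Fin N → ℝ) : N * meanValue x = ∑ j, x j := by
  rcases N.eq_zero_or_pos with rfl | hN
  · simp
  · unfold meanValue
    field_simp

theorem meanValue_add {N : ℕ} (x y : Fin N → ℝ) :
    meanValue (fun j => x j + y j) = meanValue x + meanValue y := by
  simp only [meanValue, Finset.sum_add_distrib, mul_add]

theorem meanValue_sub {N : ℕ} (x y : Fin N → ℝ) :
    meanValue (fun j => x j - y j) = meanValue x - meanValue y := by
  simp only [meanValue, Finset.sum_sub_distrib, mul_sub]

theorem meanValue_mul_left {N : ℕ} (c : ℝ) (x : Fin N → ℝ) :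
    meanValue (fun j => c * x j) = c * meanValue x := by
  simp only [meanValue, ← Finset.mul_sum, mul_left_comm]

theorem meanValue_sum {N : ℕ} {ι : Type*} (s : Finset ι) (x : ι → Fin N → ℝ) :
    meanValue (fun j => ∑ i ∈ s, x i j) = ∑ i ∈ s, meanValue (x i) := by
  simp only [meanValue, ← Finset.mul_sum]
  rw [Finset.sum_comm]

theorem meanValue_mono {N : ℕ} {x y : Fin N → ℝ} (h : ∀ j, x j ≤ y j) :
    meanValue x ≤ meanValue y := by
  unfold meanValue
  gcongr with j
  exact h j

theorem abs_meanValue_le {N : ℕ} {x : Fin N → ℝ} {c : ℝ} (hc : 0 ≤ c) (hx : ∀ j, |x j| ≤ c) :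
    |meanValue x| ≤ c := by
  rcases N.eq_zero_or_pos with rfl | hN
  · simpa [meanValue] using hc
  · have hsum : |∑ j, x j| ≤ N * c := by
      simpa using (Finset.abs_sum_le_sum_abs x Finset.univ).trans
        (Finset.sum_le_sum fun j _ => hx j)
    rw [meanValue, abs_mul, abs_of_nonneg (by positivity), one_div]
    exact (inv_mul_le_iff₀ (by positivity)).2 hsum

theorem meanValue_permute {α : Type*} {N : ℕ} (φ : α → ℝ) (σ : Equiv.Perm (Fin N))
    (x : Fin N → α) :
    meanValue (fun j => φ (permute σ x j)) = meanValue fun j => φ (x j) :=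
  congrArg (1 / (N : ℝ) * ·) (Equiv.sum_comp σ⁻¹ fun j => φ (x j))

theorem integrable_of_continuous {α : Type*} [TopologicalSpace α] [CompactSpace α]
    [MeasurableSpace α] [OpensMeasurableSpace α] {m : Measure α} [IsFiniteMeasure m]
    {f : α → ℝ} (hf : Continuous f) : Integrable f m :=
  hf.integrable_of_hasCompactSupport (HasCompactSupport.of_compactSpace _)

theorem isClosed_setOf_tendsto_meanValue {α : Type*} [TopologicalSpace α] [CompactSpace α]
    [MeasurableSpace α] [OpensMeasurableSpace α] (m : Measure α) [IsFiniteMeasure m]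
    (x : (N : ℕ) → Fin N → α) :
    IsClosed {φ : C(α, ℝ) |
      Tendsto (fun N => meanValue fun j => φ (x N j)) atTop (𝓝 (∫ a, φ a ∂m))} := by
  have hlip : ∀ N, LipschitzWith 1 fun φ : C(α, ℝ) => meanValue fun j => φ (x N j) := fun N =>
    LipschitzWith.of_dist_le_mul fun φ ψ => by
      rw [Real.dist_eq, ← meanValue_sub, NNReal.coe_one, one_mul]
      exact abs_meanValue_le dist_nonneg fun j =>
        (φ - ψ).norm_coe_le_norm (x N j) |>.trans_eq (dist_eq_norm φ ψ).symm
  have hcont : Continuous fun φ : C(α, ℝ) => ∫ a, φ a ∂m := by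
    refine (LipschitzWith.of_dist_le_mul (K := (m Set.univ).toNNReal) fun φ ψ => ?_).continuous
    rw [dist_eq_norm, ← integral_sub (integrable_of_continuous φ.continuous)
      (integrable_of_continuous ψ.continuous), mul_comm]
    exact norm_integral_le_of_norm_le_const (ae_of_all _ fun a => by
      rw [← dist_eq_norm]; exact ContinuousMap.dist_apply_le_dist a)
  exact (LipschitzWith.uniformEquicontinuous _ 1 hlip).equicontinuous.isClosed_setOfPred_tendsto
    hcont

/-- Moments determine the averages of polynomials, which are uniformly dense. -/
theorem tendsto_meanValue_of_tendsto_moment {a b : ℝ} (m : Measure (Set.Icc a b))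
    [IsFiniteMeasure m] {x : (N : ℕ) → Fin N → Set.Icc a b}
    (hx : ∀ k : ℕ, Tendsto (fun N => meanValue fun j => (x N j : ℝ) ^ k) atTop
      (𝓝 (∫ t, (t : ℝ) ^ k ∂m))) (φ : C(Set.Icc a b, ℝ)) :
    Tendsto (fun N => meanValue fun j => φ (x N j)) atTop (𝓝 (∫ t, φ t ∂m)) := by
  have hpoly : ∀ p : Polynomial ℝ, Tendsto (fun N => meanValue fun j => p.eval (x N j : ℝ)) atTop
      (𝓝 (∫ t, p.eval (t : ℝ) ∂m)) := fun p => by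
    simp only [Polynomial.eval_eq_sum_range, meanValue_sum, meanValue_mul_left]
    rw [integral_finsetSum _ fun k _ => (integrable_of_continuous (by fun_prop)).const_mul _]
    simp only [integral_const_mul]
    exact tendsto_finsetSum _ fun k _ => (hx k).const_mul _
  have hclosure : φ ∈ closure (polynomialFunctions (Set.Icc a b) : Set C(Set.Icc a b, ℝ)) := by
    rw [← Subalgebra.topologicalClosure_coe, polynomialFunctions_closure_eq_top]
    trivial
  refine closure_minimal ?_ (isClosed_setOf_tendsto_meanValue m x) hclosure
  rw [polynomialFunctions_coe]
  rintro _ ⟨p, rfl⟩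
  exact hpoly p

end Averages

section EmpiricalCDF

/-- The distribution function of the uniform distribution on the coordinates of `x`. -/
noncomputable def empiricalCDF {N : ℕ} (x : Fin N → ℝ) (t : ℝ) : ℝ :=
  meanValue fun j => (Set.Iic t).indicator 1 (x j)

theorem tendsto_empiricalCDF {ν : Measure ℝ} [IsProbabilityMeasure ν] {x : (N : ℕ) → Fin N → ℝ}
    (hx : ∀ φ : BoundedContinuousFunction ℝ ℝ,
      Tendsto (fun N => meanValue fun j => φ (x N j)) atTop (𝓝 (∫ t, φ t ∂ν)))
    {t : ℝ} (ht : ν {t} = 0) :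
    Tendsto (fun N => empiricalCDF (x N) t) atTop (𝓝 (ν.real (Set.Iic t))) := by
  let emp : ℕ → ProbabilityMeasure ℝ := fun N =>
    ⟨(PMF.uniformOfFintype (Fin (N + 1))).toMeasure.map (x (N + 1)),
      Measure.isProbabilityMeasure_map (measurable_of_countable _).aemeasurable⟩
  have integral_emp : ∀ N {f : ℝ → ℝ}, Measurable f →
      ∫ s, f s ∂(emp N : Measure ℝ) = meanValue fun j => f (x (N + 1) j) := fun N f hf => by
    rw [ProbabilityMeasure.coe_mk, integral_map (measurable_of_countable _).aemeasurable
      hf.aestronglyMeasurable, PMF.integral_eq_sum]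
    simp [meanValue, Finset.mul_sum, ENNReal.toReal_add]
  have hweak : Tendsto emp atTop (𝓝 ⟨ν, inferInstance⟩) := by
    refine ProbabilityMeasure.tendsto_iff_forall_integral_tendsto.2 fun φ => ?_
    simp only [integral_emp _ φ.continuous.measurable]
    exact (tendsto_add_atTop_iff_nat 1).2 (hx φ)
  have hIic := ProbabilityMeasure.tendsto_measure_of_null_frontier_of_tendsto' hweak
    (E := Set.Iic t) (by rwa [frontier_Iic])
  refine (tendsto_add_atTop_iff_nat 1).1
    (((ENNReal.tendsto_toReal (measure_ne_top ν _)).comp hIic).congr fun N => ?_)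
  rw [empiricalCDF, ← integral_emp N (measurable_one.indicator measurableSet_Iic)]
  exact (integral_indicator_one measurableSet_Iic).symm

theorem abs_indicator_Iic_sub (u v t : ℝ) :
    |(Set.Iic t).indicator (1 : ℝ → ℝ) u - (Set.Iic t).indicator 1 v|
      = (Set.Ico (min u v) (max u v)).indicator 1 t := by
  simp only [Set.indicator_apply, Set.mem_Iic, Set.mem_Ico, min_le_iff, lt_max_iff, Pi.one_apply]
  grind

theorem sum_abs_sub_eq_abs_sum_sub {ι : Type*} (s : Finset ι) {f g : ι → ℝ}
    (h : f ≤ g ∨ g ≤ f) : ∑ i ∈ s, |f i - g i| = |∑ i ∈ s, (f i - g i)| := by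
  wlog hgf : g ≤ f generalizing f g
  · simpa only [abs_sub_comm, ← Finset.sum_sub_distrib, Finset.sum_sub_distrib]
      using this h.symm (h.resolve_right hgf)
  · rw [Finset.abs_sum_of_nonneg fun i _ => sub_nonneg.2 (hgf i)]
    exact Finset.sum_congr rfl fun i _ => abs_of_nonneg (sub_nonneg.2 (hgf i))

theorem indicator_Iic_comp_le_or_le {ι : Type*} [LinearOrder ι] {x y : ι → ℝ} (hx : Monotone x)
    (hy : Monotone y) (t : ℝ) :
    ((Set.Iic t).indicator 1 ∘ x : ι → ℝ) ≤ (Set.Iic t).indicator 1 ∘ y ∨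
      ((Set.Iic t).indicator 1 ∘ y : ι → ℝ) ≤ (Set.Iic t).indicator 1 ∘ x :=
  (((isLowerSet_Iic t).preimage hx).total ((isLowerSet_Iic t).preimage hy)).imp
    (Set.indicator_le_indicator_of_subset · (zero_le_one' (ι → ℝ)))
    (Set.indicator_le_indicator_of_subset · (zero_le_one' (ι → ℝ)))

/-- The monotone rearrangement is an optimal coupling on the line, so that the transport cost is
the `L¹` distance of the distribution functions. -/
theorem meanValue_dist_eq_integral {N : ℕ} {x y : Fin N → ℝ} (hx : Monotone x)
    (hy : Monotone y) :
    meanValue (fun j => dist (x j) (y j)) = ∫ t, |empiricalCDF x t - empiricalCDF y t| := by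
  have habs : ∀ t, |empiricalCDF x t - empiricalCDF y t|
      = meanValue fun j => (Set.Ico (min (x j) (y j)) (max (x j) (y j))).indicator 1 t := by
    intro t
    simp only [empiricalCDF, ← meanValue_sub, ← abs_indicator_Iic_sub]
    rw [meanValue, meanValue, abs_mul, abs_of_nonneg (a := 1 / (N : ℝ)) (by positivity)]
    exact congrArg _ (sum_abs_sub_eq_abs_sum_sub _ (indicator_Iic_comp_le_or_le hx hy t)).symm
  simp only [habs, meanValue]
  rw [integral_const_mul, integral_finsetSum _ fun j _ =>
    (integrable_indicator_iff measurableSet_Ico).2 (integrableOn_const measure_Ico_lt_top.ne)]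
  congr! 2 with j
  rw [integral_indicator_one measurableSet_Ico, Real.volume_real_Ico, max_sub_min_eq_abs',
    max_eq_left (abs_nonneg _), Real.dist_eq]

end EmpiricalCDF

section ApproximatingSequence

theorem monotone_empiricalCDF {N : ℕ} (x : Fin N → ℝ) : Monotone (empiricalCDF x) := by
  intro s t hst
  unfold empiricalCDF meanValue
  gcongr with j
  exact Set.indicator_le_indicator_of_subset (Set.Iic_subset_Iic.2 hst) (zero_le_one' (ℝ → ℝ)) _

theorem abs_empiricalCDF_sub_le {a b : ℝ} {N : ℕ} {x y : Fin N → ℝ}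
    (hx : ∀ j, x j ∈ Set.Icc a b) (hy : ∀ j, y j ∈ Set.Icc a b) (t : ℝ) :
    |empiricalCDF x t - empiricalCDF y t| ≤ (Set.Icc a b).indicator 1 t := by
  rw [empiricalCDF, empiricalCDF, ← meanValue_sub]
  refine abs_meanValue_le (Set.indicator_nonneg (by simp) t) fun j => ?_
  rw [abs_indicator_Iic_sub]
  exact Set.indicator_le_indicator_of_subset (Set.Ico_subset_Icc_self.trans
    (Set.Icc_subset_Icc (le_min (hx j).1 (hy j).1) (max_le (hx j).2 (hy j).2)))
    (zero_le_one' (ℝ → ℝ)) t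

theorem ae_tendsto_empiricalCDF {a b : ℝ} {m : Measure (Set.Icc a b)} [IsProbabilityMeasure m]
    {x : (N : ℕ) → Fin N → Set.Icc a b} (hx : ∀ φ : C(Set.Icc a b, ℝ),
      Tendsto (fun N => meanValue fun j => φ (x N j)) atTop (𝓝 (∫ s, φ s ∂m))) :
    ∀ᵐ t, Tendsto (fun N => empiricalCDF (fun j => (x N j : ℝ)) t) atTop
      (𝓝 ((m.map Subtype.val).real (Set.Iic t))) := by
  have := Measure.isProbabilityMeasure_map (μ := m) measurable_subtype_coe.aemeasurable
  filter_upwards [(Measure.countable_meas_level_set_pos (μ := m.map Subtype.val)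
    measurable_id).ae_notMem volume] with t ht
  refine tendsto_empiricalCDF (fun φ => ?_) (by simpa using ht)
  rw [integral_map measurable_subtype_coe.aemeasurable φ.continuous.aestronglyMeasurable]
  exact hx ⟨fun s => φ s, by fun_prop⟩

theorem tendsto_meanValue_dist {a b : ℝ} {m : Measure (Set.Icc a b)} [IsProbabilityMeasure m]
    {x y : (N : ℕ) → Fin N → Set.Icc a b} (hxm : ∀ N, Monotone (x N)) (hym : ∀ N, Monotone (y N))
    (hx : ∀ φ : C(Set.Icc a b, ℝ),
      Tendsto (fun N => meanValue fun j => φ (x N j)) atTop (𝓝 (∫ s, φ s ∂m)))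
    (hy : ∀ φ : C(Set.Icc a b, ℝ),
      Tendsto (fun N => meanValue fun j => φ (y N j)) atTop (𝓝 (∫ s, φ s ∂m))) :
    Tendsto (fun N => meanValue fun j => dist (x N j) (y N j)) atTop (𝓝 0) := by
  have hlim : Tendsto (fun N => ∫ t, |empiricalCDF (fun j => (x N j : ℝ)) t
      - empiricalCDF (fun j => (y N j : ℝ)) t|) atTop (𝓝 (∫ _ : ℝ, 0)) := by
    refine tendsto_integral_of_dominated_convergence ((Set.Icc a b).indicator 1)
      (fun N => ((monotone_empiricalCDF _).measurable.sub
        (monotone_empiricalCDF _).measurable).abs.aestronglyMeasurable)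
      ((integrable_indicator_iff measurableSet_Icc).2 (integrableOn_const measure_Icc_lt_top.ne))
      (fun N => ae_of_all _ fun t => ?_) ?_
    · rw [Real.norm_eq_abs, abs_abs]
      exact abs_empiricalCDF_sub_le (fun j => (x N j).2) (fun j => (y N j).2) t
    · filter_upwards [ae_tendsto_empiricalCDF hx, ae_tendsto_empiricalCDF hy] with t hxt hyt
      simpa using (hxt.sub hyt).abs
  rw [integral_zero] at hlim
  exact hlim.congr fun N => (meanValue_dist_eq_integral (hxm N) (hym N)).symm

variable {R : ℝ} {n : ℕ} {μ : Fin n → ProbabilityMeasure (SymInterval R)}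
  {Ξ Ξ' : (N : ℕ) → Fin n → Fin N → SymInterval R}

theorem IsApproximatingSequence.tendsto_meanValue (hΞ : IsApproximatingSequence Ξ μ) (i : Fin n)
    (φ : C(SymInterval R, ℝ)) :
    Tendsto (fun N => meanValue fun j => φ (Ξ N i j)) atTop
      (𝓝 (∫ x, φ x ∂(μ i : Measure (SymInterval R)))) :=
  tendsto_meanValue_of_tendsto_moment _ (hΞ.tendsto_moment i) φ

theorem IsApproximatingSequence.tendsto_meanValue_dist (hΞ : IsApproximatingSequence Ξ μ)
    (hΞ' : IsApproximatingSequence Ξ' μ) (i : Fin n) :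
    Tendsto (fun N => meanValue fun j => dist (Ξ N i j) (Ξ' N i j)) atTop (𝓝 0) :=
  _root_.tendsto_meanValue_dist (hΞ.monotone · i) (hΞ'.monotone · i)
    (hΞ.tendsto_meanValue i) (hΞ'.tendsto_meanValue i)

end ApproximatingSequence

section FiniteMutualPressure

variable {R : ℝ} {n N : ℕ}

/-- The average over all tuples of permutations inside the logarithm which defines the mutual
pressure. -/
noncomputable def permAverage (h : C(Fin n → SymInterval R, ℝ))
    (x : Fin n → Fin N → SymInterval R) : ℝ :=
  (1 / (N.factorial : ℝ) ^ n) * ∑ σ : Fin n → Equiv.Perm (Fin N),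
    Real.exp (N * meanValue (applyCoordwise h (fun i => permute (σ i) (x i))))

/-- The mutual pressure of finite vectors, whose upper limit along an approximating sequence is
the mutual pressure. -/
noncomputable def finiteMutualPressure (h : C(Fin n → SymInterval R, ℝ))
    (x : Fin n → Fin N → SymInterval R) : ℝ :=
  (1 / (N : ℝ)) * Real.log (permAverage h x)

theorem mutualPressure_eq_limsup (h : C(Fin n → SymInterval R, ℝ))
    (Ξ : (N : ℕ) → Fin n → Fin N → SymInterval R) :
    mutualPressure h Ξ = limsup (fun N => (finiteMutualPressure h (Ξ N) : EReal)) atTop := rfl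

theorem permAverage_pos (h : C(Fin n → SymInterval R, ℝ)) (x : Fin n → Fin N → SymInterval R) :
    0 < permAverage h x :=
  mul_pos (by positivity) (Finset.sum_pos (fun _ _ => Real.exp_pos _) Finset.univ_nonempty)

theorem permAverage_permute (h : C(Fin n → SymInterval R, ℝ))
    (x : Fin n → Fin N → SymInterval R) (τ : Fin n → Equiv.Perm (Fin N)) :
    permAverage h (fun i => permute (τ i) (x i)) = permAverage h x := by
  unfold permAverage
  congr 1
  exact Fintype.sum_equiv (Equiv.mulRight τ) _ _ fun σ => by congr 2

theorem finiteMutualPressure_permute (h : C(Fin n → SymInterval R, ℝ))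
    (x : Fin n → Fin N → SymInterval R) (τ : Fin n → Equiv.Perm (Fin N)) :
    finiteMutualPressure h (fun i => permute (τ i) (x i)) = finiteMutualPressure h x := by
  rw [finiteMutualPressure, permAverage_permute, finiteMutualPressure]

theorem exp_natCast_mul_finiteMutualPressure (h : C(Fin n → SymInterval R, ℝ))
    (x : Fin n → Fin N → SymInterval R) :
    Real.exp (N * finiteMutualPressure h x) = permAverage h x := by
  rcases N.eq_zero_or_pos with rfl | hN
  · simp [permAverage]
  · rw [finiteMutualPressure, ← mul_assoc, mul_one_div_cancel (by positivity), one_mul,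
      Real.exp_log (permAverage_pos h x)]

theorem finiteMutualPressure_le_add {h g : C(Fin n → SymInterval R, ℝ)}
    {x y : Fin n → Fin N → SymInterval R} {c : ℝ}
    (H : ∀ σ : Fin n → Equiv.Perm (Fin N),
      meanValue (applyCoordwise h fun i => permute (σ i) (x i))
        ≤ c + meanValue (applyCoordwise g fun i => permute (σ i) (y i))) :
    finiteMutualPressure h x ≤ c + finiteMutualPressure g y := by
  rcases N.eq_zero_or_pos with rfl | hN
  · simpa [finiteMutualPressure, meanValue] using H fun _ => 1
  · refine le_of_mul_le_mul_left (Real.exp_le_exp.1 ?_) (Nat.cast_pos.2 hN : (0 : ℝ) < N)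
    rw [mul_add, Real.exp_add, exp_natCast_mul_finiteMutualPressure,
      exp_natCast_mul_finiteMutualPressure, permAverage, permAverage, mul_left_comm,
      Finset.mul_sum _ _ (Real.exp _)]
    gcongr with σ
    rw [← Real.exp_add, ← mul_add]
    gcongr
    exact H σ

theorem exists_modulus {ι α : Type*} [Fintype ι] [PseudoMetricSpace α] [CompactSpace α]
    (h : C(ι → α, ℝ)) {ε : ℝ} (hε : 0 < ε) :
    ∃ K : ℝ, 0 ≤ K ∧ ∀ y z, |h y - h z| ≤ ε + K * ∑ i, dist (y i) (z i) := by
  obtain ⟨δ, hδ, hh⟩ := Metric.uniformContinuous_iff.1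
    (CompactSpace.uniformContinuous_of_continuous h.continuous) ε hε
  refine ⟨2 * ‖h‖ / δ, by positivity, fun y z => ?_⟩
  rcases lt_or_ge (dist y z) δ with hyz | hyz
  · exact (hh hyz).le.trans (le_add_of_nonneg_right (by positivity))
  · have hdist : δ ≤ ∑ i, dist (y i) (z i) := hyz.trans <|
      (dist_pi_le_iff (by positivity)).2 fun i =>
        Finset.single_le_sum (f := fun i => dist (y i) (z i)) (fun _ _ => dist_nonneg)
          (Finset.mem_univ i)
    calc |h y - h z| ≤ ‖h‖ + ‖h‖ :=
          (norm_sub_le _ _).trans (add_le_add (h.norm_coe_le_norm y) (h.norm_coe_le_norm z))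
      _ = 0 + 2 * ‖h‖ / δ * δ := by field_simp; ring
      _ ≤ ε + 2 * ‖h‖ / δ * ∑ i, dist (y i) (z i) := by gcongr

theorem exists_abs_finiteMutualPressure_sub_le (h : C(Fin n → SymInterval R, ℝ)) {ε : ℝ}
    (hε : 0 < ε) :
    ∃ K : ℝ, ∀ (N : ℕ) (x y : Fin n → Fin N → SymInterval R),
      |finiteMutualPressure h x - finiteMutualPressure h y|
        ≤ ε + K * ∑ i, meanValue fun j => dist (x i j) (y i j) := by
  obtain ⟨K, _, hmod⟩ := exists_modulus h hε
  have of_le : ∀ {N : ℕ} (x y : Fin n → Fin N → SymInterval R), finiteMutualPressure h x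
      ≤ ε + K * ∑ i, meanValue (fun j => dist (x i j) (y i j)) + finiteMutualPressure h y := by
    intro N x y
    refine finiteMutualPressure_le_add fun σ => ?_
    have hperm : ∀ i, meanValue (fun j => dist (permute (σ i) (x i) j) (permute (σ i) (y i) j))
        = meanValue fun j => dist (x i j) (y i j) := fun i =>
      meanValue_permute (fun p : SymInterval R × SymInterval R => dist p.1 p.2) (σ i)
        fun j => (x i j, y i j)
    rw [← sub_le_iff_le_add, ← meanValue_sub]
    refine (meanValue_mono fun j => (le_abs_self _).trans (hmod _ _)).trans ?_
    rw [meanValue_add (fun _ => ε), meanValue_mul_left, meanValue_sum,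
      Finset.sum_congr rfl fun i _ => hperm i]
    gcongr
    exact (le_abs_self _).trans (abs_meanValue_le hε.le fun _ => (abs_of_pos hε).le)
  refine ⟨K, fun N x y => abs_sub_le_iff.2 ⟨sub_le_iff_le_add.2 (of_le x y), ?_⟩⟩
  simpa only [dist_comm, sub_le_iff_le_add] using of_le y x

theorem IsApproximatingSequence.tendsto_finiteMutualPressure_sub
    {μ : Fin n → ProbabilityMeasure (SymInterval R)}
    {Ξ Ξ' : (N : ℕ) → Fin n → Fin N → SymInterval R} (hΞ : IsApproximatingSequence Ξ μ)
    (hΞ' : IsApproximatingSequence Ξ' μ) (h : C(Fin n → SymInterval R, ℝ)) :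
    Tendsto (fun N => finiteMutualPressure h (Ξ N) - finiteMutualPressure h (Ξ' N)) atTop
      (𝓝 0) := by
  refine Metric.tendsto_nhds.2 fun ε hε => ?_
  obtain ⟨K, hK⟩ := exists_abs_finiteMutualPressure_sub_le h (half_pos hε)
  have hlim : Tendsto (fun N => ε / 2 + K * ∑ i, meanValue fun j => dist (Ξ N i j) (Ξ' N i j))
      atTop (𝓝 (ε / 2 + K * ∑ _ : Fin n, 0)) :=
    ((tendsto_finsetSum _ fun i _ => hΞ.tendsto_meanValue_dist hΞ' i).const_mul K).const_add _
  filter_upwards [hlim.eventually_lt_const (u := ε) (by simpa using half_lt_self hε)] with N hN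
  rw [dist_zero_right]
  exact (hK N _ _).trans_lt hN

/-- The potential of particles which do not interact, each exposed to its own field. -/
def separablePotential (f : Fin n → C(SymInterval R, ℝ)) : C(Fin n → SymInterval R, ℝ) :=
  ⟨fun x => ∑ i, f i (x i), by fun_prop⟩

theorem separablePotential_single (i : Fin n) (φ : C(SymInterval R, ℝ))
    (x : Fin n → SymInterval R) : separablePotential (Pi.single i φ) x = φ (x i) := by
  refine (Finset.sum_eq_single i (fun j _ hj => ?_)
    fun hi => (hi (Finset.mem_univ i)).elim).trans ?_
  · rw [Pi.single_eq_of_ne hj, ContinuousMap.zero_apply]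
  · rw [Pi.single_eq_same]

theorem finiteMutualPressure_add_separablePotential (h : C(Fin n → SymInterval R, ℝ))
    (f : Fin n → C(SymInterval R, ℝ)) (x : Fin n → Fin N → SymInterval R) :
    finiteMutualPressure (h + separablePotential f) x
      = ∑ i, meanValue (fun j => f i (x i j)) + finiteMutualPressure h x := by
  have hmean : ∀ σ : Fin n → Equiv.Perm (Fin N),
      meanValue (applyCoordwise (h + separablePotential f) fun i => permute (σ i) (x i))
        = ∑ i, meanValue (fun j => f i (x i j))
          + meanValue (applyCoordwise h fun i => permute (σ i) (x i)) := fun σ => by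
    rw [add_comm, ← Finset.sum_congr rfl fun i _ => meanValue_permute (f i) (σ i) (x i),
      ← meanValue_sum, ← meanValue_add]
    rfl
  refine le_antisymm (finiteMutualPressure_le_add fun σ => (hmean σ).le) ?_
  rw [← le_neg_add_iff_add_le]
  exact finiteMutualPressure_le_add fun σ => by rw [hmean, neg_add_cancel_left]

theorem IsApproximatingSequence.mutualPressure_add_separablePotential
    {μ : Fin n → ProbabilityMeasure (SymInterval R)}
    {Ξ : (N : ℕ) → Fin n → Fin N → SymInterval R} (hΞ : IsApproximatingSequence Ξ μ)
    (h : C(Fin n → SymInterval R, ℝ)) (f : Fin n → C(SymInterval R, ℝ)) :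
    mutualPressure (h + separablePotential f) Ξ
      = ((∑ i, ∫ x, f i x ∂(μ i : Measure (SymInterval R)) : ℝ) : EReal) + mutualPressure h Ξ := by
  have hlim := EReal.tendsto_coe.2 <|
    tendsto_finsetSum Finset.univ fun i _ => hΞ.tendsto_meanValue i (f i)
  simp only [mutualPressure_eq_limsup, finiteMutualPressure_add_separablePotential, EReal.coe_add]
  refine le_antisymm ?_ ?_
  · rw [← hlim.limsup_eq]
    exact EReal.limsup_add_le (by simp [hlim.limsup_eq]) (by simp [hlim.limsup_eq])
  · rw [← hlim.liminf_eq, add_comm]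
    exact EReal.le_limsup_add.trans_eq (by simp only [Pi.add_def, add_comm])

end FiniteMutualPressure

section Sampling

theorem ae_tendsto_meanValue {α : Type*} [MeasurableSpace α] (ν : Measure α)
    [IsProbabilityMeasure ν] {f : α → ℝ} (hf : Measurable f) (hfi : Integrable f ν) :
    ∀ᵐ ω ∂(Measure.infinitePi fun _ : ℕ => ν),
      Tendsto (fun N => meanValue fun j : Fin N => f (ω j)) atTop (𝓝 (∫ x, f x ∂ν)) := by
  have heval := fun i : ℕ => measurePreserving_eval_infinitePi (fun _ : ℕ => ν) i
  have hdist : ∀ i : ℕ, (Measure.infinitePi fun _ : ℕ => ν).map (fun ω => f (ω i)) = ν.map f :=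
    fun i => by
      conv_rhs => rw [← (heval i).map_eq, Measure.map_map hf (heval i).measurable]
      rfl
  have hlln := ProbabilityTheory.strong_law_ae_real (fun (i : ℕ) (ω : ℕ → α) => f (ω i))
    ((heval 0).integrable_comp_of_integrable hfi)
    (fun i j hij => (ProbabilityTheory.iIndepFun_infinitePi (X := fun _ => f)
      fun _ => hf).indepFun hij)
    (fun i => ⟨(hf.comp (heval i).measurable).aemeasurable,
      (hf.comp (heval 0).measurable).aemeasurable, by rw [hdist, hdist]⟩)
  have hmean : ∫ ω : ℕ → α, f (ω 0) ∂(Measure.infinitePi fun _ : ℕ => ν) = ∫ x, f x ∂ν := by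
    rw [← integral_map (heval 0).aemeasurable hf.aestronglyMeasurable, (heval 0).map_eq]
  filter_upwards [hlln] with ω hω
  rw [hmean] at hω
  refine hω.congr fun N => ?_
  rw [meanValue, Finset.sum_range, one_div, inv_mul_eq_div]

variable {R : ℝ} {n : ℕ} {μ : Fin n → ProbabilityMeasure (SymInterval R)}
  {ν : Measure (Fin n → SymInterval R)} [IsProbabilityMeasure ν]

theorem ae_isApproximatingSequence_sort
    (hν : ∀ i, (μ i : Measure (SymInterval R)) = ν.map fun x => x i) :
    ∀ᵐ ω ∂(Measure.infinitePi fun _ : ℕ => ν), IsApproximatingSequence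
      (fun N i => permute (Tuple.sort fun j : Fin N => ω j i)⁻¹ fun j => ω j i) μ := by
  have hmoment : ∀ᵐ ω ∂(Measure.infinitePi fun _ : ℕ => ν), ∀ (i : Fin n) (k : ℕ),
      Tendsto (fun N => meanValue fun j : Fin N => (ω j i : ℝ) ^ k) atTop
        (𝓝 (∫ x, (x i : ℝ) ^ k ∂ν)) :=
    ae_all_iff.2 fun i => ae_all_iff.2 fun k =>
      ae_tendsto_meanValue ν (f := fun x => (x i : ℝ) ^ k) (by fun_prop)
        (integrable_of_continuous (by fun_prop))
  filter_upwards [hmoment] with ω hω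
  refine ⟨fun N i => Tuple.monotone_sort fun j : Fin N => ω j i, fun i k => ?_⟩
  rw [hν i, integral_map (measurable_pi_apply i).aemeasurable
    (Continuous.aestronglyMeasurable (by fun_prop))]
  exact (hω i k).congr fun N => (meanValue_permute (fun t : SymInterval R => (t : ℝ) ^ k) _ _).symm

theorem exists_isApproximatingSequence (μ : Fin n → ProbabilityMeasure (SymInterval R)) :
    ∃ Ξ : (N : ℕ) → Fin n → Fin N → SymInterval R, IsApproximatingSequence Ξ μ :=
  let ⟨_, hω⟩ := (ae_isApproximatingSequence_sort
    (ν := Measure.pi fun i => (μ i : Measure (SymInterval R)))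
    fun i => (measurePreserving_eval
      (fun i => (μ i : Measure (SymInterval R))) i).map_eq.symm).exists
  ⟨_, hω⟩

theorem continuous_finiteMutualPressure {N : ℕ} (h : C(Fin n → SymInterval R, ℝ)) :
    Continuous (finiteMutualPressure (N := N) h) := by
  unfold finiteMutualPressure
  refine continuous_const.mul (Continuous.log ?_ fun x => (permAverage_pos h x).ne')
  unfold permAverage meanValue applyCoordwise permute
  fun_prop

theorem abs_finiteMutualPressure_sub_le {N : ℕ} (h : C(Fin n → SymInterval R, ℝ))
    (x y : Fin n → Fin N → SymInterval R) :
    |finiteMutualPressure h x - finiteMutualPressure h y| ≤ 2 * ‖h‖ := by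
  have hmean : ∀ z : Fin n → Fin N → SymInterval R, |meanValue (applyCoordwise h z)| ≤ ‖h‖ :=
    fun z => abs_meanValue_le (norm_nonneg h) fun j => h.norm_coe_le_norm _
  have of_le : ∀ x y : Fin n → Fin N → SymInterval R,
      finiteMutualPressure h x ≤ 2 * ‖h‖ + finiteMutualPressure h y := fun x y =>
    finiteMutualPressure_le_add fun σ => by
      linarith [(abs_le.1 (hmean fun i => permute (σ i) (x i))).2,
        (abs_le.1 (hmean fun i => permute (σ i) (y i))).1]
  exact abs_sub_le_iff.2 ⟨sub_le_iff_le_add.2 (of_le x y), sub_le_iff_le_add.2 (of_le y x)⟩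

theorem IsApproximatingSequence.tendsto_integral_finiteMutualPressure_sub
    {Ξ : (N : ℕ) → Fin n → Fin N → SymInterval R} (hΞ : IsApproximatingSequence Ξ μ)
    (hν : ∀ i, (μ i : Measure (SymInterval R)) = ν.map fun x => x i)
    (h : C(Fin n → SymInterval R, ℝ)) :
    Tendsto (fun N => ∫ x, finiteMutualPressure h (fun i j => x j i)
        ∂(Measure.pi fun _ : Fin N => ν) - finiteMutualPressure h (Ξ N)) atTop (𝓝 0) := by
  have hcont : ∀ N, Continuous fun x : Fin N → Fin n → SymInterval R =>
      finiteMutualPressure h fun i j => x j i := fun N =>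
    (continuous_finiteMutualPressure h).comp (by fun_prop)
  have hmp : ∀ N, MeasurePreserving (fun (ω : ℕ → Fin n → SymInterval R) (j : Fin N) => ω j)
      (Measure.infinitePi fun _ => ν) (Measure.pi fun _ => ν) := fun N =>
    ⟨measurable_pi_lambda _ fun j => measurable_pi_apply _, by
      rw [← Measure.infinitePi_eq_pi]
      exact Measure.map_infinitePi_infinitePi_of_inj Fin.val_injective⟩
  have hsample : ∀ N, ∫ x, finiteMutualPressure h (fun i j => x j i)
        ∂(Measure.pi fun _ : Fin N => ν) - finiteMutualPressure h (Ξ N)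
      = ∫ ω : ℕ → Fin n → SymInterval R, (finiteMutualPressure h (fun i (j : Fin N) => ω j i)
          - finiteMutualPressure h (Ξ N)) ∂(Measure.infinitePi fun _ => ν) := fun N => by
    calc _ = ∫ x, (finiteMutualPressure h (fun i j => x j i) - finiteMutualPressure h (Ξ N))
          ∂(Measure.pi fun _ : Fin N => ν) := by
          rw [integral_sub (integrable_of_continuous (hcont N)) (integrable_const _),
            integral_const, probReal_univ, one_smul]
      _ = _ := by
          rw [← (hmp N).map_eq]
          exact integral_map (hmp N).aemeasurable
            ((hcont N).sub continuous_const).aestronglyMeasurable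
  simp only [hsample]
  rw [← integral_zero (ℕ → Fin n → SymInterval R) ℝ (μ := Measure.infinitePi fun _ : ℕ => ν)]
  refine tendsto_integral_of_dominated_convergence (fun _ => 2 * ‖h‖)
    (fun N => (((hcont N).measurable.comp (hmp N).measurable).sub_const _).aestronglyMeasurable)
    (integrable_const _) (fun N => ae_of_all _ fun ω => abs_finiteMutualPressure_sub_le h _ _) ?_
  filter_upwards [ae_isApproximatingSequence_sort hν] with ω hω
  simpa only [finiteMutualPressure_permute] using hω.tendsto_finiteMutualPressure_sub hΞ h

end Sampling

section Symmetrisation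

variable {n N : ℕ}

theorem measurePreserving_permute_columns {α : Type*} [MeasurableSpace α]
    (m : Fin n → Measure α) [∀ i, IsFiniteMeasure (m i)] (σ : Fin n → Equiv.Perm (Fin N)) :
    MeasurePreserving (fun (x : Fin N → Fin n → α) j i => permute (σ i) (fun k => x k i) j)
      (Measure.pi fun _ => Measure.pi m) (Measure.pi fun _ => Measure.pi m) := by
  have hmeas : Measurable fun (x : Fin N → Fin n → α) j i => permute (σ i) (fun k => x k i) j := by
    unfold permute
    fun_prop
  refine ⟨hmeas, (Measure.pi_eq_generateFrom
    (C := fun _ => Set.pi Set.univ '' Set.pi Set.univ fun _ => {s | MeasurableSet s})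
    (fun _ => generateFrom_pi) (fun _ => isPiSystem_pi)
    (fun _ => Measure.FiniteSpanningSetsIn.pi fun i => (m i).toFiniteSpanningSetsIn) ?_).symm⟩
  intro s hs
  choose t ht hts using hs
  obtain rfl : (fun j => Set.pi Set.univ (t j)) = s := funext hts
  have hpre : (fun (x : Fin N → Fin n → α) j i => permute (σ i) (fun k => x k i) j) ⁻¹'
        (Set.pi Set.univ fun j => Set.pi Set.univ (t j))
      = Set.pi Set.univ fun j => Set.pi Set.univ fun i => t (σ i j) i := by
    ext x
    simp only [Set.mem_preimage, Set.mem_pi, Set.mem_univ, true_imp_iff, permute]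
    exact ⟨fun H j i => by simpa using H (σ i j) i, fun H j i => by simpa using H ((σ i)⁻¹ j) i⟩
  rw [Measure.map_apply hmeas
    (MeasurableSet.univ_pi fun j => MeasurableSet.univ_pi fun i => ht j i trivial), hpre]
  simp only [Measure.pi_pi]
  rw [Finset.prod_comm, Finset.prod_comm (s := Finset.univ (α := Fin N))]
  exact Finset.prod_congr rfl fun i _ => Equiv.prod_comp (σ i) fun j => m i (t j i)

variable {R : ℝ}

theorem integral_mul_permAverage (m : Fin n → Measure (SymInterval R)) [∀ i, IsFiniteMeasure (m i)]
    (h : C(Fin n → SymInterval R, ℝ)) {F : (Fin n → Fin N → SymInterval R) → ℝ}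
    (hF : Continuous F) (hinv : ∀ (σ : Fin n → Equiv.Perm (Fin N)) x,
      F (fun i => permute (σ i) (x i)) = F x) :
    ∫ x, F (fun i j => x j i) * permAverage h (fun i j => x j i)
        ∂(Measure.pi fun _ : Fin N => Measure.pi m)
      = ∫ x, F (fun i j => x j i) * Real.exp (∑ j, h (x j))
        ∂(Measure.pi fun _ : Fin N => Measure.pi m) := by
  let G : (Fin N → Fin n → SymInterval R) → ℝ := fun x =>
    F (fun i j => x j i) * Real.exp (∑ j, h (x j))
  let T : (Fin n → Equiv.Perm (Fin N)) → (Fin N → Fin n → SymInterval R) →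
      Fin N → Fin n → SymInterval R := fun σ x j i => permute (σ i) (fun k => x k i) j
  have hG : Continuous G := (hF.comp (by fun_prop)).mul (by fun_prop)
  have hGTc : ∀ σ, Continuous fun x => G (T σ x) := fun σ => hG.comp (by unfold T permute; fun_prop)
  have hGT : ∀ σ, ∫ x, G (T σ x) ∂(Measure.pi fun _ => Measure.pi m)
      = ∫ x, G x ∂(Measure.pi fun _ => Measure.pi m) := fun σ => by
    have hmp := measurePreserving_permute_columns m σ
    conv_rhs => rw [← hmp.map_eq]
    exact (integral_map hmp.aemeasurable hG.aestronglyMeasurable).symm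
  have hexpand : ∀ x : Fin N → Fin n → SymInterval R,
      F (fun i j => x j i) * permAverage h (fun i j => x j i)
        = 1 / (N.factorial : ℝ) ^ n * ∑ σ, G (T σ x) := fun x => by
    simp only [permAverage, natCast_mul_meanValue, Finset.mul_sum, mul_left_comm (F _), G, T]
    exact Finset.sum_congr rfl fun σ _ => by rw [hinv σ fun i k => x k i]; rfl
  simp only [hexpand]
  rw [integral_const_mul,
    integral_finsetSum _ fun σ _ => integrable_of_continuous (hGTc σ)]
  simp only [hGT, Finset.sum_const, Finset.card_univ, Fintype.card_pi_const, Fintype.card_perm,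
    Fintype.card_fin, nsmul_eq_mul, Nat.cast_pow]
  rw [← mul_assoc, one_div_mul_cancel (by positivity), one_mul]

theorem integral_permAverage (m : Fin n → Measure (SymInterval R)) [∀ i, IsFiniteMeasure (m i)]
    (h : C(Fin n → SymInterval R, ℝ)) :
    ∫ x, permAverage h (fun i j => x j i) ∂(Measure.pi fun _ : Fin N => Measure.pi m)
      = (∫ x, Real.exp (h x) ∂(Measure.pi m)) ^ N := by
  have hsymm := integral_mul_permAverage (N := N) m h (F := fun _ => 1) continuous_const
    fun _ _ => rfl
  simp only [one_mul, Real.exp_sum] at hsymm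
  rw [hsymm, integral_fintype_prod_eq_pow fun x => Real.exp (h x), Fintype.card_fin]

end Symmetrisation

section ProductDensity

variable {ι : Type*} [Fintype ι] {α : ι → Type*} [∀ i, MeasurableSpace (α i)]

theorem pi_withDensity_ofReal (m : ∀ i, Measure (α i)) [∀ i, IsFiniteMeasure (m i)]
    {q : ∀ i, α i → ℝ} (hq : ∀ i, 0 ≤ q i) (hqm : ∀ i, Integrable (q i) (m i)) :
    Measure.pi (fun i => (m i).withDensity fun x => ENNReal.ofReal (q i x))
      = (Measure.pi m).withDensity fun x => ENNReal.ofReal (∏ i, q i (x i)) := by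
  have : ∀ i, IsFiniteMeasure ((m i).withDensity fun x => ENNReal.ofReal (q i x)) :=
    fun i => isFiniteMeasure_withDensity_ofReal (hqm i).2
  refine Measure.pi_eq fun s hs => ?_
  have hpi : MeasurableSet (Set.univ.pi s) := MeasurableSet.univ_pi hs
  have hprod : (Set.univ.pi s).indicator (fun x => ∏ i, q i (x i))
      = fun x => ∏ i, (s i).indicator (q i) (x i) := by
    classical
    funext x
    simp only [Set.indicator_apply, Finset.prod_ite_zero, Set.mem_univ_pi, Finset.mem_univ,
      true_imp_iff]
  rw [withDensity_apply _ hpi, ← ofReal_integral_eq_lintegral_ofReal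
      (Integrable.fintype_prod_dep hqm).integrableOn
      (ae_of_all _ fun x => Finset.prod_nonneg fun i _ => hq i _),
    ← integral_indicator hpi, hprod, integral_fintype_prod_eq_prod (fun i => (s i).indicator (q i)),
    ENNReal.ofReal_prod_of_nonneg
      fun i _ => integral_nonneg fun x => Set.indicator_nonneg (fun y _ => hq i y) x]
  refine Finset.prod_congr rfl fun i _ => ?_
  rw [withDensity_apply _ (hs i), integral_indicator (hs i),
    ofReal_integral_eq_lintegral_ofReal (hqm i).integrableOn (ae_of_all _ (hq i))]

theorem pi_tilted (m : ∀ i, Measure (α i)) [∀ i, IsFiniteMeasure (m i)] {f : ∀ i, α i → ℝ}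
    (hf : ∀ i, Integrable (fun x => Real.exp (f i x)) (m i)) :
    Measure.pi (fun i => (m i).tilted (f i)) = (Measure.pi m).tilted fun x => ∑ i, f i (x i) := by
  simp only [Measure.tilted, Real.exp_sum]
  rw [pi_withDensity_ofReal m (q := fun i x => Real.exp (f i x) / ∫ y, Real.exp (f i y) ∂(m i))
      (fun i x => by positivity) fun i => (hf i).div_const _,
    integral_fintype_prod_eq_prod fun i x => Real.exp (f i x)]
  simp only [Finset.prod_div_distrib]

variable {μ m : ∀ i, Measure (α i)} [∀ i, IsFiniteMeasure (μ i)] [∀ i, IsFiniteMeasure (m i)]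

theorem pi_eq_withDensity_prod_rnDeriv (h : ∀ i, μ i ≪ m i) :
    Measure.pi μ = (Measure.pi m).withDensity fun x =>
      ENNReal.ofReal (∏ i, ((μ i).rnDeriv (m i) (x i)).toReal) := by
  rw [← pi_withDensity_ofReal m (q := fun i x => ((μ i).rnDeriv (m i) x).toReal)
    (fun i x => ENNReal.toReal_nonneg) fun i => Measure.integrable_toReal_rnDeriv]
  congr with i : 1
  rw [withDensity_congr_ae (Measure.rnDeriv_lt_top (μ i) (m i) |>.mono fun x hx =>
    ENNReal.ofReal_toReal hx.ne), Measure.withDensity_rnDeriv_eq _ _ (h i)]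

theorem pi_absolutelyContinuous_pi (h : ∀ i, μ i ≪ m i) : Measure.pi μ ≪ Measure.pi m := by
  rw [pi_eq_withDensity_prod_rnDeriv h]
  exact withDensity_absolutelyContinuous _ _

theorem llr_pi (h : ∀ i, μ i ≪ m i) :
    llr (Measure.pi μ) (Measure.pi m) =ᵐ[Measure.pi μ] fun x => ∑ i, llr (μ i) (m i) (x i) := by
  have hrn : (Measure.pi μ).rnDeriv (Measure.pi m) =ᵐ[Measure.pi m] fun x =>
      ENNReal.ofReal (∏ i, ((μ i).rnDeriv (m i) (x i)).toReal) := by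
    rw [pi_eq_withDensity_prod_rnDeriv h]
    exact Measure.rnDeriv_withDensity _ (by fun_prop)
  have hpos : ∀ᵐ x ∂(Measure.pi μ), ∀ i, ((μ i).rnDeriv (m i) (x i)).toReal ≠ 0 :=
    ae_all_iff.2 fun i => Measure.tendsto_eval_ae_ae.eventually <| by
      filter_upwards [Measure.rnDeriv_pos (h i), (h i).ae_le (Measure.rnDeriv_ne_top (μ i) (m i))]
        with x hx hx' using (ENNReal.toReal_pos hx.ne' hx').ne'
  filter_upwards [(pi_absolutelyContinuous_pi h).ae_le hrn, hpos] with x hx hx0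
  simp only [llr_def]
  rw [hx, ENNReal.toReal_ofReal (Finset.prod_nonneg fun i _ => ENNReal.toReal_nonneg),
    Real.log_prod fun i _ => hx0 i]

end ProductDensity

section RelativeEntropy

variable {ι : Type*} [Fintype ι] {α : ι → Type*} [∀ i, MeasurableSpace (α i)]
  {μ m : ∀ i, Measure (α i)} [∀ i, IsProbabilityMeasure (μ i)] [∀ i, IsFiniteMeasure (m i)]

theorem integrable_llr_pi (h : ∀ i, μ i ≪ m i) (hint : ∀ i, Integrable (llr (μ i) (m i)) (μ i)) :
    Integrable (llr (Measure.pi μ) (Measure.pi m)) (Measure.pi μ) :=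
  (integrable_finsetSum _ fun i _ => integrable_comp_eval (hint i)).congr (llr_pi h).symm

theorem integral_llr_pi (h : ∀ i, μ i ≪ m i) (hint : ∀ i, Integrable (llr (μ i) (m i)) (μ i)) :
    ∫ x, llr (Measure.pi μ) (Measure.pi m) x ∂(Measure.pi μ)
      = ∑ i, ∫ x, llr (μ i) (m i) x ∂(μ i) := by
  rw [integral_congr_ae (llr_pi h), integral_finsetSum _ fun i _ => integrable_comp_eval (hint i)]
  exact Finset.sum_congr rfl fun i _ => integral_comp_eval (measurable_llr _ _).aestronglyMeasurable

theorem integral_llr_nonneg {Ω : Type*} [MeasurableSpace Ω] {ρ m : Measure Ω}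
    [IsProbabilityMeasure ρ] [IsProbabilityMeasure m] (h : ρ ≪ m)
    (hint : Integrable (llr ρ m) ρ) : 0 ≤ ∫ x, llr ρ m x ∂ρ := by
  simpa only [probReal_univ, add_sub_cancel_right]
    using InformationTheory.integral_llr_add_sub_measure_univ_nonneg h hint

/-- The Donsker–Varadhan inequality. -/
theorem integral_le_log_integral_exp_add_integral_llr {Ω : Type*} [MeasurableSpace Ω]
    {ρ m : Measure Ω} [IsProbabilityMeasure ρ] [IsFiniteMeasure m] {f : Ω → ℝ} (h : ρ ≪ m)
    (hint : Integrable (llr ρ m) ρ) (hf : Integrable f ρ)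
    (hexp : Integrable (fun x => Real.exp (f x)) m) :
    ∫ x, f x ∂ρ ≤ Real.log (∫ x, Real.exp (f x) ∂m) + ∫ x, llr ρ m x ∂ρ := by
  have : NeZero m := ⟨fun hm => IsProbabilityMeasure.ne_zero ρ
    (Measure.absolutelyContinuous_zero_iff.1 (hm ▸ h))⟩
  have := isProbabilityMeasure_tilted hexp
  have hnonneg := integral_llr_nonneg (h.trans (absolutelyContinuous_tilted hexp))
    (integrable_llr_tilted_right h hf hint hexp)
  rw [integral_llr_tilted_right h hf hexp hint] at hnonneg
  linarith

theorem log_integral_exp_le_integral_tilted {Ω : Type*} [MeasurableSpace Ω] {ρ : Measure Ω}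
    [IsProbabilityMeasure ρ] {f : Ω → ℝ} (hexp : Integrable (fun x => Real.exp (f x)) ρ)
    (hf : Integrable f (ρ.tilted f)) :
    Real.log (∫ x, Real.exp (f x) ∂ρ) ≤ ∫ x, f x ∂(ρ.tilted f) := by
  have := isProbabilityMeasure_tilted hexp
  have hllr : llr (ρ.tilted f) ρ =ᵐ[ρ.tilted f] fun x => f x - Real.log (∫ y, Real.exp (f y) ∂ρ) :=
    (tilted_absolutelyContinuous ρ f).ae_le (log_rnDeriv_tilted_left_self hexp)
  have hnonneg := integral_llr_nonneg (tilted_absolutelyContinuous ρ f)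
    ((hf.sub (integrable_const _)).congr hllr.symm)
  rwa [integral_congr_ae hllr, integral_sub hf (integrable_const _), integral_const,
    probReal_univ, one_smul, sub_nonneg] at hnonneg

end RelativeEntropy

section VariationalBounds

variable {R : ℝ} {n N : ℕ}

theorem integral_finiteMutualPressure_le (hN : 0 < N) {μ m : Fin n → Measure (SymInterval R)}
    [∀ i, IsProbabilityMeasure (μ i)] [∀ i, IsFiniteMeasure (m i)] (hμ : ∀ i, μ i ≪ m i)
    (hint : ∀ i, Integrable (llr (μ i) (m i)) (μ i)) (h : C(Fin n → SymInterval R, ℝ)) :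
    ∫ x, finiteMutualPressure h (fun i j => x j i) ∂(Measure.pi fun _ : Fin N => Measure.pi μ)
      ≤ Real.log (∫ x, Real.exp (h x) ∂(Measure.pi m)) + ∑ i, ∫ x, llr (μ i) (m i) x ∂(μ i) := by
  have hcont : Continuous fun x : Fin N → Fin n → SymInterval R =>
      N * finiteMutualPressure h fun i j => x j i :=
    continuous_const.mul ((continuous_finiteMutualPressure h).comp (by fun_prop))
  have hpi := pi_absolutelyContinuous_pi hμ
  have hpi_int := integrable_llr_pi hμ hint
  have hdv := integral_le_log_integral_exp_add_integral_llr
    (pi_absolutelyContinuous_pi fun _ : Fin N => hpi) (integrable_llr_pi (fun _ => hpi)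
      fun _ => hpi_int) (integrable_of_continuous hcont) (integrable_of_continuous hcont.rexp)
  simp only [exp_natCast_mul_finiteMutualPressure] at hdv
  rw [integral_permAverage, Real.log_pow, integral_llr_pi (fun _ => hpi) fun _ => hpi_int,
    integral_llr_pi hμ hint, Finset.sum_const, Finset.card_univ, Fintype.card_fin, nsmul_eq_mul,
    integral_const_mul, ← mul_add] at hdv
  exact le_of_mul_le_mul_left hdv (Nat.cast_pos.2 hN)

theorem integral_finiteMutualPressure_tilted (ρ : Fin n → Measure (SymInterval R))
    [∀ i, IsProbabilityMeasure (ρ i)] (g : C(Fin n → SymInterval R, ℝ)) :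
    ∫ x, finiteMutualPressure g (fun i j => x j i)
        ∂((Measure.pi fun _ : Fin N => Measure.pi ρ).tilted
          fun x => N * finiteMutualPressure g fun i j => x j i)
      = ∫ x, finiteMutualPressure g (fun i j => x j i)
        ∂(Measure.pi fun _ : Fin N => (Measure.pi ρ).tilted g) := by
  have hsymm := integral_mul_permAverage ρ g (continuous_finiteMutualPressure (N := N) g)
    fun σ x => finiteMutualPressure_permute g x σ
  have hmass := integral_fintype_prod_eq_pow (ι := Fin N) (μ := Measure.pi ρ)
    fun y => Real.exp (g y)
  rw [pi_tilted _ fun _ => integrable_of_continuous (by fun_prop), integral_tilted,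
    integral_tilted]
  simp only [exp_natCast_mul_finiteMutualPressure, integral_permAverage, Real.exp_sum,
    smul_eq_mul, div_mul_eq_mul_div, integral_div, mul_comm (finiteMutualPressure _ _)] at hsymm ⊢
  rw [hmass, Fintype.card_fin, hsymm]

theorem log_integral_exp_le_integral_finiteMutualPressure (hN : 0 < N)
    (ρ : Fin n → Measure (SymInterval R)) [∀ i, IsProbabilityMeasure (ρ i)]
    (g : C(Fin n → SymInterval R, ℝ)) :
    Real.log (∫ x, Real.exp (g x) ∂(Measure.pi ρ))
      ≤ ∫ x, finiteMutualPressure g (fun i j => x j i)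
        ∂(Measure.pi fun _ : Fin N => (Measure.pi ρ).tilted g) := by
  have hcont : Continuous fun x : Fin N → Fin n → SymInterval R =>
      N * finiteMutualPressure g fun i j => x j i :=
    continuous_const.mul ((continuous_finiteMutualPressure g).comp (by fun_prop))
  have hjensen := log_integral_exp_le_integral_tilted
    (ρ := Measure.pi fun _ : Fin N => Measure.pi ρ) (integrable_of_continuous hcont.rexp)
    (integrable_of_continuous hcont)
  rw [integral_const_mul, integral_finiteMutualPressure_tilted] at hjensen
  simp only [exp_natCast_mul_finiteMutualPressure] at hjensen
  rw [integral_permAverage, Real.log_pow] at hjensen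
  exact le_of_mul_le_mul_left hjensen (Nat.cast_pos.2 hN)

variable {μ : Fin n → ProbabilityMeasure (SymInterval R)}
  {Ξ : (N : ℕ) → Fin n → Fin N → SymInterval R} {ν : Measure (Fin n → SymInterval R)}
  [IsProbabilityMeasure ν] {h : C(Fin n → SymInterval R, ℝ)} {c : ℝ}

theorem IsApproximatingSequence.mutualPressure_le (hΞ : IsApproximatingSequence Ξ μ)
    (hν : ∀ i, (μ i : Measure (SymInterval R)) = ν.map fun x => x i)
    (hc : ∀ N, 0 < N → ∫ x, finiteMutualPressure h (fun i j => x j i)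
      ∂(Measure.pi fun _ : Fin N => ν) ≤ c) :
    mutualPressure h Ξ ≤ c := by
  have hlim := (hΞ.tendsto_integral_finiteMutualPressure_sub hν h).const_sub c
  rw [sub_zero] at hlim
  rw [mutualPressure_eq_limsup, ← (EReal.tendsto_coe.2 hlim).limsup_eq]
  refine limsup_le_limsup ?_
  filter_upwards [eventually_gt_atTop 0] with N hN
  exact EReal.coe_le_coe_iff.2 (by linarith [hc N hN])

theorem IsApproximatingSequence.le_mutualPressure (hΞ : IsApproximatingSequence Ξ μ)
    (hν : ∀ i, (μ i : Measure (SymInterval R)) = ν.map fun x => x i)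
    (hc : ∀ N, 0 < N → c ≤ ∫ x, finiteMutualPressure h (fun i j => x j i)
      ∂(Measure.pi fun _ : Fin N => ν)) :
    c ≤ mutualPressure h Ξ := by
  have hlim := (hΞ.tendsto_integral_finiteMutualPressure_sub hν h).const_sub c
  rw [sub_zero] at hlim
  rw [mutualPressure_eq_limsup, ← (EReal.tendsto_coe.2 hlim).limsup_eq]
  refine limsup_le_limsup ?_
  filter_upwards [eventually_gt_atTop 0] with N hN
  exact EReal.coe_le_coe_iff.2 (by linarith [hc N hN])

end VariationalBounds

section Pressure

variable {R : ℝ} {n : ℕ}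

theorem volume_symInterval_univ :
    (volume : Measure (SymInterval R)) Set.univ = ENNReal.ofReal (R - -R) := by
  rw [← Real.volume_Icc]
  exact Measure.Subtype.volume_univ measurableSet_Icc.nullMeasurableSet

instance isFiniteMeasure_volume_symInterval :
    IsFiniteMeasure (volume : Measure (SymInterval R)) :=
  ⟨volume_symInterval_univ.trans_lt ENNReal.ofReal_lt_top⟩

theorem neZero_volume_symInterval (hR : 0 < R) : NeZero (volume : Measure (SymInterval R)) :=
  ⟨fun hzero => by
    have hpos : 0 < ENNReal.ofReal (R - -R) := ENNReal.ofReal_pos.2 (by linarith)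
    rw [← volume_symInterval_univ, hzero, Measure.coe_zero, Pi.zero_apply] at hpos
    exact hpos.false⟩

theorem neZero_volume_cube (hR : 0 < R) (ι : Type*) [Fintype ι] :
    NeZero (volume : Measure (ι → SymInterval R)) := by
  have := neZero_volume_symInterval hR
  refine ⟨fun hzero => ?_⟩
  have huniv := Measure.pi_univ fun _ : ι => (volume : Measure (SymInterval R))
  rw [← volume_pi, hzero, Measure.coe_zero, Pi.zero_apply] at huniv
  exact Finset.prod_ne_zero_iff.2 (fun _ _ => NeZero.ne _) huniv.symm

theorem isProbabilityMeasure_gibbsMeasure (hR : 0 < R) (h : C(Fin n → SymInterval R, ℝ)) :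
    IsProbabilityMeasure (gibbsMeasure h) := by
  have := neZero_volume_cube hR (Fin n)
  exact isProbabilityMeasure_tilted (integrable_of_continuous (by fun_prop))

theorem integral_exp_cube_pos (hR : 0 < R) {ι : Type*} [Fintype ι]
    {f : (ι → SymInterval R) → ℝ} (hf : Continuous f) : 0 < ∫ x, Real.exp (f x) := by
  have := neZero_volume_cube hR ι
  exact integral_exp_pos (integrable_of_continuous hf.rexp)

theorem log_integral_exp_gibbsMeasure (hR : 0 < R) (h g : C(Fin n → SymInterval R, ℝ)) :
    Real.log (∫ x, Real.exp (g x) ∂(gibbsMeasure h)) = pressure (h + g) - pressure h := by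
  rw [gibbsMeasure, integral_exp_tilted, ← ContinuousMap.coe_add,
    Real.log_div (integral_exp_cube_pos hR (map_continuous _)).ne'
      (integral_exp_cube_pos hR h.continuous).ne', pressure, pressure]

theorem tilted_gibbsMeasure (h g : C(Fin n → SymInterval R, ℝ)) :
    (gibbsMeasure h).tilted g = gibbsMeasure (h + g) := by
  rw [gibbsMeasure, tilted_tilted (integrable_of_continuous (by fun_prop)),
    ← ContinuousMap.coe_add, gibbsMeasure]

theorem gibbsMeasure_separablePotential (f : Fin n → C(SymInterval R, ℝ)) :
    gibbsMeasure (separablePotential f) = Measure.pi fun i => gibbsMeasure (f i) :=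
  (pi_tilted _ fun _ => integrable_of_continuous (by fun_prop)).symm

theorem pressure_separablePotential (hR : 0 < R) (f : Fin n → C(SymInterval R, ℝ)) :
    pressure (separablePotential f) = ∑ i, Real.log (∫ x, Real.exp (f i x)) := by
  have := neZero_volume_symInterval hR
  have hprod : ∫ x, Real.exp (separablePotential f x) = ∏ i, ∫ x, Real.exp (f i x) := by
    rw [volume_pi, ← integral_fintype_prod_eq_prod fun i x => Real.exp (f i x)]
    simp only [separablePotential, ContinuousMap.coe_mk, Real.exp_sum]
  rw [pressure, hprod, Real.log_prod fun i _ =>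
    (integral_exp_pos (integrable_of_continuous (by fun_prop))).ne']

end Pressure

section Entropy

variable {R : ℝ} {n : ℕ}

theorem entropy_eq_neg_integral_llr {μ : ProbabilityMeasure (SymInterval R)}
    (hac : (μ : Measure (SymInterval R)) ≪ volume)
    (hint : Integrable (llr (μ : Measure (SymInterval R)) volume) (μ : Measure (SymInterval R))) :
    entropy μ = ((-∫ x, llr (μ : Measure (SymInterval R)) volume x
      ∂(μ : Measure (SymInterval R)) : ℝ) : EReal) := by
  rw [entropy, if_pos ⟨hac, (integrable_rnDeriv_mul_log_iff hac).2 hint⟩,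
    integral_rnDeriv_mul_log hac]

theorem absolutelyContinuous_and_integrable_llr_of_entropy_ne_bot
    {μ : ProbabilityMeasure (SymInterval R)} (h : entropy μ ≠ ⊥) :
    (μ : Measure (SymInterval R)) ≪ volume ∧
      Integrable (llr (μ : Measure (SymInterval R)) volume) (μ : Measure (SymInterval R)) := by
  obtain ⟨hac, hint⟩ := not_imp_comm.1 (fun hnot => if_neg hnot) h
  exact ⟨hac, (integrable_rnDeriv_mul_log_iff hac).1 hint⟩

theorem entropy_of_eq_gibbsMeasure {μ : ProbabilityMeasure (SymInterval R)}
    {f : SymInterval R → ℝ} (hf : Continuous f)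
    (hμ : (μ : Measure (SymInterval R)) = gibbsMeasure f) :
    entropy μ = ((Real.log (∫ x, Real.exp (f x)) - ∫ x, f x ∂(μ : Measure (SymInterval R)) : ℝ) :
      EReal) := by
  have hac : (μ : Measure (SymInterval R)) ≪ volume := hμ ▸ tilted_absolutelyContinuous _ _
  have hllr : llr (μ : Measure (SymInterval R)) volume =ᵐ[(μ : Measure (SymInterval R))]
      fun x => f x - Real.log (∫ y, Real.exp (f y)) := by
    refine hac.ae_le ?_
    rw [hμ]
    exact log_rnDeriv_tilted_left_self (integrable_of_continuous hf.rexp)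
  have hf_int := integrable_of_continuous (m := (μ : Measure (SymInterval R))) hf
  rw [entropy_eq_neg_integral_llr hac ((hf_int.sub (integrable_const _)).congr hllr.symm),
    integral_congr_ae hllr, integral_sub hf_int (integrable_const _), integral_const,
    probReal_univ, one_smul, neg_sub]

theorem sum_entropy_eq_bot {μ : Fin n → ProbabilityMeasure (SymInterval R)} {i : Fin n}
    (hi : entropy (μ i) = ⊥) : ∑ i, entropy (μ i) = ⊥ := by
  rw [← Finset.add_sum_erase _ _ (Finset.mem_univ i), hi, EReal.bot_add]

theorem sum_entropy_eq_coe {μ : Fin n → ProbabilityMeasure (SymInterval R)} {H : Fin n → ℝ}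
    (hH : ∀ i, entropy (μ i) = H i) : ∑ i, entropy (μ i) = ((∑ i, H i : ℝ) : EReal) := by
  rw [Finset.sum_congr rfl fun i _ => hH i]
  exact (map_sum (⟨⟨Real.toEReal, EReal.coe_zero⟩, EReal.coe_add⟩ : ℝ →+ EReal) H _).symm

theorem IsApproximatingSequence.mutualPressure_add_sum_entropy_le
    {μ : Fin n → ProbabilityMeasure (SymInterval R)}
    {Ξ : (N : ℕ) → Fin n → Fin N → SymInterval R} (hΞ : IsApproximatingSequence Ξ μ)
    (h : C(Fin n → SymInterval R, ℝ)) :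
    mutualPressure h Ξ + ∑ i, entropy (μ i) ≤ pressure h := by
  by_cases hbot : ∃ i, entropy (μ i) = ⊥
  · obtain ⟨i, hi⟩ := hbot
    rw [sum_entropy_eq_bot hi, EReal.add_bot]
    exact bot_le
  have hμ := fun i =>
    absolutelyContinuous_and_integrable_llr_of_entropy_ne_bot (not_exists.1 hbot i)
  have hle := hΞ.mutualPressure_le (h := h)
    (fun i => (measurePreserving_eval (fun i => (μ i : Measure (SymInterval R))) i).map_eq.symm)
    fun N hN => integral_finiteMutualPressure_le hN (fun i => (hμ i).1) (fun i => (hμ i).2) h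
  rw [sum_entropy_eq_coe fun i => entropy_eq_neg_integral_llr (hμ i).1 (hμ i).2]
  refine (add_le_add_left hle _).trans_eq ?_
  rw [← EReal.coe_add, Finset.sum_neg_distrib, add_neg_cancel_right, pressure, volume_pi]

end Entropy

section EqualityCase

theorem integral_eq_of_forall_mul_le_cgf {Ω : Type*} [MeasurableSpace Ω] {ρ : Measure Ω}
    [IsProbabilityMeasure ρ] {F : Ω → ℝ} {a : ℝ}
    (h0 : (0 : ℝ) ∈ interior (ProbabilityTheory.integrableExpSet F ρ))
    (hF : ∀ t, t * a ≤ ProbabilityTheory.cgf F ρ t) : ∫ ω, F ω ∂ρ = a := by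
  have hderiv := (ProbabilityTheory.analyticAt_cgf h0).differentiableAt.hasDerivAt
  rw [ProbabilityTheory.deriv_cgf_zero h0, probReal_univ, div_one] at hderiv
  have hmin : IsLocalMin (fun t => ProbabilityTheory.cgf F ρ t - t * a) 0 :=
    Eventually.of_forall fun t => by
      simpa only [ProbabilityTheory.cgf_zero, zero_mul, sub_zero, sub_nonneg] using hF t
  exact sub_eq_zero.1 (hmin.hasDerivAt_eq_zero (hderiv.sub (hasDerivAt_mul_const a)))

variable {R : ℝ} {n : ℕ} {h : C(Fin n → SymInterval R, ℝ)}
  {μ : Fin n → ProbabilityMeasure (SymInterval R)}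
  {Ξ : (N : ℕ) → Fin n → Fin N → SymInterval R}

theorem eq_map_gibbsMeasure_of_forall_le_pressure (hR : 0 < R)
    (hμ : ∀ f : Fin n → C(SymInterval R, ℝ),
      ∑ i, ∫ x, f i x ∂(μ i : Measure (SymInterval R)) + pressure h
        ≤ pressure (h + separablePotential f)) (i : Fin n) :
    (μ i : Measure (SymInterval R)) = (gibbsMeasure h).map fun x => x i := by
  have := isProbabilityMeasure_gibbsMeasure hR h
  have := Measure.isProbabilityMeasure_map (μ := gibbsMeasure h)
    (measurable_pi_apply i).aemeasurable
  refine ext_of_forall_integral_eq_of_IsFiniteMeasure fun φ => ?_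
  rw [integral_map (measurable_pi_apply i).aemeasurable φ.continuous.aestronglyMeasurable]
  have hexp : ProbabilityTheory.integrableExpSet (fun x => φ (x i)) (gibbsMeasure h) = Set.univ :=
    Set.eq_univ_of_forall fun t => integrable_of_continuous (by fun_prop)
  refine (integral_eq_of_forall_mul_le_cgf (by simp [hexp]) fun t => ?_).symm
  let f : Fin n → C(SymInterval R, ℝ) := Pi.single i (t • φ.toContinuousMap)
  have hsep : ∀ x, separablePotential f x = t * φ (x i) := separablePotential_single i _
  have hsum : ∑ j, ∫ x, f j x ∂(μ j : Measure (SymInterval R))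
      = t * ∫ x, φ x ∂(μ i : Measure (SymInterval R)) := by
    rw [Finset.sum_eq_single i (fun j _ hj => by simp [f, hj]) (by simp), ← integral_const_mul]
    simp [f]
  have hcgf := log_integral_exp_gibbsMeasure hR h (separablePotential f)
  simp only [hsep] at hcgf
  rw [ProbabilityTheory.cgf, ProbabilityTheory.mgf, hcgf, ← hsum]
  exact le_sub_iff_add_le.2 (hμ f)

theorem IsApproximatingSequence.eq_map_gibbsMeasure (hΞ : IsApproximatingSequence Ξ μ)
    (hR : 0 < R) (heq : (pressure h : EReal) = mutualPressure h Ξ + ∑ i, entropy (μ i))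
    (i : Fin n) : (μ i : Measure (SymInterval R)) = (gibbsMeasure h).map fun x => x i := by
  refine eq_map_gibbsMeasure_of_forall_le_pressure hR (fun f => ?_) i
  have hle := hΞ.mutualPressure_add_sum_entropy_le (h + separablePotential f)
  rwa [hΞ.mutualPressure_add_separablePotential, add_assoc, ← heq, ← EReal.coe_add,
    EReal.coe_le_coe_iff] at hle

theorem IsApproximatingSequence.pressure_sub_le_mutualPressure (hΞ : IsApproximatingSequence Ξ μ)
    (hR : 0 < R) (hμ : ∀ i, (μ i : Measure (SymInterval R)) = (gibbsMeasure h).map fun x => x i)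
    (f : Fin n → C(SymInterval R, ℝ)) :
    ((pressure h - pressure (separablePotential f)
      + ∑ i, ∫ x, f i x ∂(μ i : Measure (SymInterval R)) : ℝ) : EReal) ≤ mutualPressure h Ξ := by
  have := isProbabilityMeasure_gibbsMeasure hR h
  have := neZero_volume_symInterval hR
  have hprob : ∀ i, IsProbabilityMeasure (gibbsMeasure (f i)) := fun i =>
    isProbabilityMeasure_tilted (integrable_of_continuous (by fun_prop))
  obtain ⟨g, rfl⟩ : ∃ g, h = separablePotential f + g := ⟨_, (add_sub_cancel _ h).symm⟩
  have hgibbs : (Measure.pi fun i => gibbsMeasure (f i)).tilted g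
      = gibbsMeasure (separablePotential f + g) := by
    rw [← gibbsMeasure_separablePotential, tilted_gibbsMeasure]
  have hle := hΞ.le_mutualPressure hμ fun N hN => hgibbs ▸
    log_integral_exp_le_integral_finiteMutualPressure hN (fun i => gibbsMeasure (f i)) g
  rw [← gibbsMeasure_separablePotential, log_integral_exp_gibbsMeasure hR] at hle
  rw [add_comm _ g, hΞ.mutualPressure_add_separablePotential, add_comm g, add_comm (_ - _),
    EReal.coe_add]
  exact add_le_add_right hle _

end EqualityCase

section Marginals

variable {R : ℝ} {n : ℕ}

theorem funSplitAt_symm_eq_dite {ι α : Type*} [DecidableEq ι] [TopologicalSpace α] (i : ι)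
    (p : α × ({j // j ≠ i} → α)) :
    (Homeomorph.funSplitAt α i).symm p = fun j => if hj : j = i then p.1 else p.2 ⟨j, hj⟩ :=
  funext fun _ => Homeomorph.funSplitAt_symm_apply _ _ _ _

theorem measurePreserving_funSplitAt_symm {ι α : Type*} [Fintype ι] [DecidableEq ι]
    [TopologicalSpace α] [SecondCountableTopology α] [MeasureSpace α] [BorelSpace α]
    [SigmaFinite (volume : Measure α)] (i : ι) :
    MeasurePreserving (Homeomorph.funSplitAt α i).symm (volume.prod volume) volume := by
  have hmeas := (Homeomorph.funSplitAt α i).symm.continuous.measurable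
  refine ⟨hmeas, Eq.symm <| Measure.pi_eq fun s hs => ?_⟩
  have hpreimage : (Homeomorph.funSplitAt α i).symm ⁻¹' Set.univ.pi s
      = s i ×ˢ Set.univ.pi fun j : {j // j ≠ i} => s j := by
    ext p
    simp only [Set.mem_preimage, Set.mem_prod, Set.mem_univ_pi, funSplitAt_symm_eq_dite,
      Subtype.forall]
    refine ⟨fun hp => ⟨by simpa using hp i, fun j hj => by simpa [hj] using hp j⟩,
      fun hp j => ?_⟩
    rcases eq_or_ne j i with rfl | hj
    · simpa using hp.1
    · simpa [hj] using hp.2 j hj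
  rw [Measure.map_apply hmeas (.univ_pi hs), hpreimage, Measure.prod_prod, volume_pi,
    Measure.pi_pi, Fintype.prod_eq_mul_prod_subtype_ne _ i]

theorem continuous_dite_eq_coord (i : Fin n) :
    Continuous fun p : SymInterval R × ({j : Fin n // j ≠ i} → SymInterval R) =>
      fun j => if hj : j = i then p.1 else p.2 ⟨j, hj⟩ :=
  (Homeomorph.funSplitAt (SymInterval R) i).symm.continuous.congr (funSplitAt_symm_eq_dite i)

theorem integral_cube_eq_integral_integral {F : (Fin n → SymInterval R) → ℝ} (hF : Continuous F)
    (i : Fin n) :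
    ∫ x, F x = ∫ x : SymInterval R, ∫ y : {j : Fin n // j ≠ i} → SymInterval R,
      F fun j => if hj : j = i then x else y ⟨j, hj⟩ := by
  have hsplit := measurePreserving_funSplitAt_symm (α := SymInterval R) i
  rw [← hsplit.map_eq, integral_map hsplit.measurable.aemeasurable hF.aestronglyMeasurable,
    integral_prod _ (integrable_of_continuous (by fun_prop))]
  simp only [funSplitAt_symm_eq_dite]

theorem exp_marginalPotential (hR : 0 < R) (h : C(Fin n → SymInterval R, ℝ)) (i : Fin n)
    (x : SymInterval R) :
    Real.exp (marginalPotential h i x) = ∫ y : {j : Fin n // j ≠ i} → SymInterval R,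
      Real.exp (h fun j => if hj : j = i then x else y ⟨j, hj⟩) :=
  Real.exp_log (integral_exp_cube_pos hR
    (h.continuous.comp ((continuous_dite_eq_coord i).comp (Continuous.prodMk_right x))))

theorem continuous_marginalPotential (hR : 0 < R) (h : C(Fin n → SymInterval R, ℝ)) (i : Fin n) :
    Continuous (marginalPotential h i) := by
  have hint := continuous_parametric_integral_of_continuous (μ := volume)
    (f := fun x (y : {j : Fin n // j ≠ i} → SymInterval R) =>
      Real.exp (h fun j => if hj : j = i then x else y ⟨j, hj⟩))
    (h.continuous.comp (continuous_dite_eq_coord i)).rexp isCompact_univ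
  rw [Measure.restrict_univ] at hint
  refine hint.log fun x => ?_
  rw [← exp_marginalPotential hR]
  exact Real.exp_ne_zero _

theorem map_gibbsMeasure (hR : 0 < R) (h : C(Fin n → SymInterval R, ℝ)) (i : Fin n) :
    (gibbsMeasure h).map (fun x => x i) = gibbsMeasure (marginalPotential h i) := by
  have := neZero_volume_symInterval hR
  have := isProbabilityMeasure_gibbsMeasure hR h
  have := Measure.isProbabilityMeasure_map (μ := gibbsMeasure h)
    (measurable_pi_apply i).aemeasurable
  have : IsProbabilityMeasure (gibbsMeasure (marginalPotential h i)) :=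
    isProbabilityMeasure_tilted
      (integrable_of_continuous (continuous_marginalPotential hR h i).rexp)
  refine ext_of_forall_integral_eq_of_IsFiniteMeasure fun φ => ?_
  rw [integral_map (measurable_pi_apply i).aemeasurable φ.continuous.aestronglyMeasurable,
    gibbsMeasure, gibbsMeasure, integral_tilted, integral_tilted]
  simp only [smul_eq_mul, div_mul_eq_mul_div, integral_div]
  rw [integral_cube_eq_integral_integral (by fun_prop) i,
    integral_cube_eq_integral_integral (by fun_prop) i]
  simp only [exp_marginalPotential hR, dite_true, integral_mul_const]

end Marginals

theorem IsApproximatingSequence.pressure_le_mutualPressure_add_sum_entropy {R : ℝ} (hR : 0 < R)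
    {n : ℕ} {h : C(Fin n → SymInterval R, ℝ)} {μ : Fin n → ProbabilityMeasure (SymInterval R)}
    {Ξ : (N : ℕ) → Fin n → Fin N → SymInterval R} (hΞ : IsApproximatingSequence Ξ μ)
    (hμ : ∀ i, (μ i : Measure (SymInterval R)) = (gibbsMeasure h).map fun x => x i) :
    pressure h ≤ mutualPressure h Ξ + ∑ i, entropy (μ i) := by
  have hcont := continuous_marginalPotential hR h
  have hle := hΞ.pressure_sub_le_mutualPressure hR hμ fun i => ⟨marginalPotential h i, hcont i⟩
  rw [sum_entropy_eq_coe fun i => entropy_of_eq_gibbsMeasure (hcont i)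
    ((hμ i).trans (map_gibbsMeasure hR h i))]
  refine le_of_eq_of_le ?_ (add_le_add_left hle _)
  rw [← EReal.coe_add, pressure_separablePotential hR, Finset.sum_sub_distrib]
  simp only [ContinuousMap.coe_mk]
  congr 1
  ring

theorem theorem3p2 {R : ℝ} (hR : 0 < R) {n : ℕ} (h : C(Fin n → SymInterval R, ℝ))
    (μ : Fin n → ProbabilityMeasure (SymInterval R)) :
    (∃ Ξ : (N : ℕ) → Fin n → Fin N → SymInterval R, IsApproximatingSequence Ξ μ) ∧
    (∀ i, Continuous (marginalPotential h i)) ∧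
    ∀ Ξ : (N : ℕ) → Fin n → Fin N → SymInterval R, IsApproximatingSequence Ξ μ →
      mutualPressure h Ξ + ∑ i, entropy (μ i) ≤ (pressure h : EReal) ∧
      List.TFAE [
        (pressure h : EReal) = mutualPressure h Ξ + ∑ i, entropy (μ i),
        ∀ i, (μ i : Measure (SymInterval R)) = (gibbsMeasure h).map (fun x => x i),
        ∀ i, (μ i : Measure (SymInterval R)) = gibbsMeasure (marginalPotential h i)] := by
  refine ⟨exists_isApproximatingSequence μ, continuous_marginalPotential hR h, fun Ξ hΞ => ?_⟩
  have hle := hΞ.mutualPressure_add_sum_entropy_le h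
  refine ⟨hle, ?_⟩
  tfae_have 1 → 2 := hΞ.eq_map_gibbsMeasure hR
  tfae_have 2 → 1 := fun hμ =>
    le_antisymm (hΞ.pressure_le_mutualPressure_add_sum_entropy hR hμ) hle
  tfae_have 2 ↔ 3 := by simp only [map_gibbsMeasure hR]
  tfae_finish
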